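/- Let $d$ be a natural number, $\mathbb{T}^d=\mathbb{R}^d/\mathbb{Z}^d$ with normalized Lebesgue measure, and let $\mathcal{S}(\mathbb{T}^d)$ be the space of smooth real-valued functions on $\mathbb{T}^d$ with the topology of uniform convergence of all derivatives. Let $\mathcal{S}'(\mathbb{T}^d)$ be its topological dual, with duality product $\langle u,\varphi\rangle$, equipped with the cylindrical $\sigma$-field, which is generated by the sets $\{u : (\langle u,\varphi_1\rangle,\dots,\langle u,\varphi_N\rangle)\in B\}$ with $N\in\mathbb{N}$, $\varphi_1,\dots,\varphi_N\in\mathcal{S}(\mathbb{T}^d)$ and $B\subset\mathbb{R}^N$ Borel. A Lévy exponent is the log-characteristic function of an infinitely divisible law, i.e. a continuous $f:\mathbb{R}\to\mathbb{C}$ with $f(0)=0$ such that $\xi\mapsto e^{f(\xi)}$ is the characteristic function of an infinitely divisible probability law on $\mathbb{R}$. A periodic Lévy white noise on a probability space $(\Omega,\mathcal{F},\mathscr{P})$ is a measurable map $w:\Omega\to\mathcal{S}'(\mathbb{T}^d)$ for which there is a Lévy exponent $f$ such that, with $\mathscr{P}_w$ the law of $w$, $$\int_{\mathcal{S}'(\mathbb{T}^d)}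 e^{\mathrm{i}\langle u,\varphi\rangle}\,\mathrm{d}\mathscr{P}_w(u)=\exp\Big(\int_{\mathbb{T}^d} f(\varphi(\mathbf{r}))\,\mathrm{d}\mathbf{r}\Big)\qquad\text{for all }\varphi\in\mathcal{S}(\mathbb{T}^d).$$ For $\tau\in\mathbb{R}$, the Sobolev space $H_2^{\tau}(\mathbb{T}^d)$ is the set of $u\in\mathcal{S}'(\mathbb{T}^d)$ with $$\|u\|_{H_2^\tau}=\Big(\sum_{n\in\mathbb{Z}^d}(1+|n|)^{2\tau}\,\big|\langle u,e^{-2\pi \mathrm{i}\langle n,\cdot\rangle}\rangle\big|^2\Big)^{1/2}<\infty,$$ where $|n|$ is the Euclidean norm and $u$ is extended complex-linearly to complex-valued smooth functions. Proposition. If $w$ is a periodic Lévy white noise and $\epsilon>0$, then $\{\omega : w(\omega)\in H_2^{-d/2-\epsilon}(\mathbb{T}^d)\}$ is an event (it is measurable) and $$\mathscr{P}\big(w\in H_2^{-d/2-\epsilon}(\mathbb{T}^d)\big)=1.$$ -/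

import Mathlib

open MeasureTheory

noncomputable section

namespace PeriodicNoise

open scoped ENNReal ContDiff

/-! ### Smooth periodic test functions -/

/-- The function on `ℝ^d` obtained by composing a function on the torus `𝕋^d = ℝ^d / ℤ^d` with the
quotient map; it is `ℤ^d`-periodic. -/
def lift {d : ℕ} (φ : UnitAddTorus (Fin d) → ℝ) (x : Fin d → ℝ) : ℝ :=
  φ (fun i => (x i : UnitAddCircle))

/-- The real vector space of smooth real-valued functions on the torus. -/
def smoothSubmodule (d : ℕ) : Submodule ℝ (UnitAddTorus (Fin d) → ℝ) where
  carrier := {φ | ContDiff ℝ ∞ (lift φ)}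
  add_mem' {φ ψ} (hφ : ContDiff ℝ ∞ (lift φ)) (hψ : ContDiff ℝ ∞ (lift ψ)) := hφ.add hψ
  zero_mem' := show ContDiff ℝ ∞ (fun _ : Fin d → ℝ => (0 : ℝ)) from contDiff_const
  smul_mem' _ {φ} (h : ContDiff ℝ ∞ (lift φ)) := contDiff_const.mul h

/-- The space `𝒮(𝕋^d)` of smooth real-valued functions on the torus. (It is not reducible, so that
it does not inherit the topology of pointwise convergence from the function space.) -/
def TestFunction (d : ℕ) : Type := smoothSubmodule d

namespace TestFunction

variable {d : ℕ}

instance : AddCommGroup (TestFunction d) := inferInstanceAs (AddCommGroup (smoothSubmodule d))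

instance : Module ℝ (TestFunction d) := inferInstanceAs (Module ℝ (smoothSubmodule d))

instance : CoeFun (TestFunction d) (fun _ => UnitAddTorus (Fin d) → ℝ) := ⟨fun φ => φ.1⟩

@[ext]
theorem ext {φ ψ : TestFunction d} (h : ∀ x, φ x = ψ x) : φ = ψ := Subtype.ext (funext h)

theorem add_apply (φ ψ : TestFunction d) (x : UnitAddTorus (Fin d)) :
    (φ + ψ) x = φ x + ψ x := rfl

theorem smul_apply (c : ℝ) (φ : TestFunction d) (x : UnitAddTorus (Fin d)) :
    (c • φ) x = c * φ x := rfl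

theorem contDiff_lift (φ : TestFunction d) : ContDiff ℝ ∞ (lift φ) := φ.2

theorem lift_add_int (φ : UnitAddTorus (Fin d) → ℝ) (x : Fin d → ℝ) (n : Fin d → ℤ) :
    lift φ (x + fun i => (n i : ℝ)) = lift φ x := by
  unfold lift
  congr 1
  funext i
  simp

theorem bddAbove_iteratedFDeriv (φ : TestFunction d) (k : ℕ) :
    BddAbove (Set.range fun x => ‖iteratedFDeriv ℝ k (lift φ) x‖) := by
  have hc : Continuous fun x => ‖iteratedFDeriv ℝ k (lift φ) x‖ :=
    (φ.contDiff_lift.continuous_iteratedFDeriv (by exact_mod_cast le_top)).norm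
  obtain ⟨C, hC⟩ := (isCompact_Icc (a := (0 : Fin d → ℝ)) (b := 1)).bddAbove_image hc.continuousOn
  refine ⟨C, ?_⟩
  rintro _ ⟨x, rfl⟩
  have hper : (fun z => lift φ (z + fun i => ((⌊x i⌋ : ℤ) : ℝ))) = lift φ :=
    funext fun z => lift_add_int φ z _
  have hx : x = (fun i => Int.fract (x i)) + fun i => ((⌊x i⌋ : ℤ) : ℝ) := by
    funext i
    simp
  have key : iteratedFDeriv ℝ k (lift φ) x
      = iteratedFDeriv ℝ k (lift φ) (fun i => Int.fract (x i)) := by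
    conv_rhs => rw [← hper, iteratedFDeriv_comp_add_right]
    rw [← hx]
  simp only [key]
  exact hC ⟨_, ⟨fun i => Int.fract_nonneg _, fun i => (Int.fract_lt_one _).le⟩, rfl⟩

/-- The seminorm `φ ↦ sup_x ‖D^k φ(x)‖` on `𝒮(𝕋^d)`. -/
def derivSeminorm (d k : ℕ) : Seminorm ℝ (TestFunction d) :=
  Seminorm.of (fun φ => ⨆ x, ‖iteratedFDeriv ℝ k (lift φ) x‖)
    (fun φ ψ => by
      refine ciSup_le fun x => ?_
      have h : iteratedFDeriv ℝ k (lift (φ + ψ : TestFunction d)) x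
          = iteratedFDeriv ℝ k (lift φ) x + iteratedFDeriv ℝ k (lift ψ) x :=
        iteratedFDeriv_add_apply
          ((φ.contDiff_lift.of_le (by exact_mod_cast le_top)).contDiffAt)
          ((ψ.contDiff_lift.of_le (by exact_mod_cast le_top)).contDiffAt)
      rw [h]
      exact (norm_add_le _ _).trans (add_le_add
        (le_ciSup (bddAbove_iteratedFDeriv φ k) x) (le_ciSup (bddAbove_iteratedFDeriv ψ k) x)))
    (fun c φ => by
      have h : ∀ x, iteratedFDeriv ℝ k (lift (c • φ : TestFunction d)) x
          = c • iteratedFDeriv ℝ k (lift φ) x := fun x =>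
        iteratedFDeriv_const_smul_apply
          ((φ.contDiff_lift.of_le (by exact_mod_cast le_top)).contDiffAt)
      simp only [h, norm_smul]
      rw [Real.mul_iSup_of_nonneg (norm_nonneg c)])

/-- The Fréchet topology of `𝒮(𝕋^d)`: uniform convergence of all derivatives. -/
instance : TopologicalSpace (TestFunction d) :=
  (SeminormFamily.moduleFilterBasis (𝕜 := ℝ) (derivSeminorm d)).topology'

theorem derivSeminorm_apply (k : ℕ) (φ : TestFunction d) :
    derivSeminorm d k φ = ⨆ x, ‖iteratedFDeriv ℝ k (lift φ) x‖ := rfl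

theorem withSeminorms : WithSeminorms (𝕜 := ℝ) (derivSeminorm d) := ⟨rfl⟩

end TestFunction

/-! ### Periodic generalized functions -/

/-- The space `𝒮'(𝕋^d)` of (real) periodic generalized functions: the topological dual of
`𝒮(𝕋^d)`. -/
abbrev GeneralizedFunction (d : ℕ) : Type := TestFunction d →L[ℝ] ℝ

/-- The cylindrical `σ`-field on `𝒮'(𝕋^d)`, generated by the sets
`{u | (⟨u, φ₁⟩, …, ⟨u, φ_N⟩) ∈ B}` with `B` a Borel subset of `ℝ^N`. -/
instance cylindricalSigmaField (d : ℕ) : MeasurableSpace (GeneralizedFunction d) :=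
  MeasurableSpace.generateFrom
    {C | ∃ (N : ℕ) (φ : Fin N → TestFunction d) (B : Set (Fin N → ℝ)),
      MeasurableSet B ∧ C = {u | (fun j => u (φ j)) ∈ B}}

/-! ### Sobolev spaces -/

theorem contDiff_mFourier {d : ℕ} (n : Fin d → ℤ) :
    ContDiff ℝ ∞ fun x : Fin d → ℝ =>
      UnitAddTorus.mFourier n (fun i => (x i : UnitAddCircle)) := by
  have h : (fun x : Fin d → ℝ => UnitAddTorus.mFourier n (fun i => (x i : UnitAddCircle)))
      = fun x => ∏ i, Complex.exp (2 * Real.pi * Complex.I * (n i) * ((x i : ℝ) : ℂ)) := by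
    funext x
    simp [UnitAddTorus.mFourier]
  rw [h]
  refine contDiff_prod fun i _ => ContDiff.cexp (contDiff_const.mul ?_)
  exact Complex.ofRealCLM.contDiff.comp (contDiff_apply ℝ ℝ i)

/-- The real part `x ↦ cos (2π ⟨n, x⟩)` of `x ↦ e^{2πi⟨n, x⟩}`, as a test function. -/
def expRe {d : ℕ} (n : Fin d → ℤ) : TestFunction d :=
  ⟨fun x => (UnitAddTorus.mFourier n x).re, Complex.reCLM.contDiff.comp (contDiff_mFourier n)⟩

theorem expRe_apply {d : ℕ} (n : Fin d → ℤ) (x : UnitAddTorus (Fin d)) :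
    expRe n x = (UnitAddTorus.mFourier n x).re := rfl

/-- The imaginary part `x ↦ sin (2π ⟨n, x⟩)` of `x ↦ e^{2πi⟨n, x⟩}`, as a test function. -/
def expIm {d : ℕ} (n : Fin d → ℤ) : TestFunction d :=
  ⟨fun x => (UnitAddTorus.mFourier n x).im, Complex.imCLM.contDiff.comp (contDiff_mFourier n)⟩

theorem expIm_apply {d : ℕ} (n : Fin d → ℤ) (x : UnitAddTorus (Fin d)) :
    expIm n x = (UnitAddTorus.mFourier n x).im := rfl

/-- The Fourier coefficient `⟨u, e^{-2πi⟨n, ·⟩}⟩` of a periodic generalized function, where `u` is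
extended complex-linearly to complex-valued test functions. -/
def fourierCoefficient {d : ℕ} (u : GeneralizedFunction d) (n : Fin d → ℤ) : ℂ :=
  (u (expRe (-n)) : ℂ) + Complex.I * (u (expIm (-n)) : ℂ)

/-- The Euclidean length `|n|` of a lattice point. -/
def latticeNorm {d : ℕ} (n : Fin d → ℤ) : ℝ := Real.sqrt (∑ i, (n i : ℝ) ^ 2)

/-- The `H_2^τ(𝕋^d)` norm, with values in `[0, ∞]`:
`(∑_n (1 + |n|)^{2τ} |⟨u, e^{-2πi⟨n, ·⟩}⟩|²)^{1/2}`. -/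
def sobolevNorm {d : ℕ} (τ : ℝ) (u : GeneralizedFunction d) : ℝ≥0∞ :=
  (∑' n : Fin d → ℤ,
    ENNReal.ofReal ((1 + latticeNorm n) ^ (2 * τ) * ‖fourierCoefficient u n‖ ^ 2)) ^ (1 / 2 : ℝ)

/-- The Sobolev space `H_2^τ(𝕋^d)`, as a subset of `𝒮'(𝕋^d)`. -/
def sobolevSpace (d : ℕ) (τ : ℝ) : Set (GeneralizedFunction d) := {u | sobolevNorm τ u < ⊤}

/-! ### Lévy exponents and periodic Lévy white noises -/

/-- A law on `ℝ` is infinitely divisible if for every `n ≥ 1` it is the law of the sum of `n`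
independent identically distributed random variables. -/
def IsInfinitelyDivisible (ν : Measure ℝ) : Prop :=
  IsProbabilityMeasure ν ∧ ∀ n : ℕ, 1 ≤ n → ∃ ρ : Measure ℝ, IsProbabilityMeasure ρ ∧
    ν = (Measure.pi fun _ : Fin n => ρ).map fun x => ∑ j, x j

/-- A Lévy exponent is the log-characteristic function of an infinitely divisible law: the
continuous `f` with `f 0 = 0` and `∫ e^{iξt} ν(dt) = e^{f ξ}`. -/
def IsLevyExponent (f : ℝ → ℂ) : Prop :=
  Continuous f ∧ f 0 = 0 ∧
    ∃ ν : Measure ℝ, IsInfinitelyDivisible ν ∧ ∀ ξ : ℝ, charFun ν ξ = Complex.exp (f ξ)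

/-- The Lebesgue measure on `𝕋^d`, i.e. the product of the Haar probability measures of the
circles. -/
def torusMeasure (d : ℕ) : Measure (UnitAddTorus (Fin d)) :=
  Measure.pi fun _ => AddCircle.haarAddCircle

variable {d : ℕ} {Ω : Type*} [MeasurableSpace Ω]

/-- The characteristic functional `φ ↦ ∫ e^{i⟨u, φ⟩} dP_w(u)` of a generalized periodic process. -/
def charFunctional (P : Measure Ω) (w : Ω → GeneralizedFunction d) (φ : TestFunction d) : ℂ :=
  ∫ u, Complex.exp (Complex.I * (u φ : ℂ)) ∂(P.map w)

/-- A periodic Lévy white noise: a generalized periodic process (a random element of `𝒮'(𝕋^d)` with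
the cylindrical `σ`-field) with characteristic functional `φ ↦ exp (∫_{𝕋^d} f (φ r) dr)` for a Lévy
exponent `f`. -/
def IsPeriodicLevyWhiteNoise (P : Measure Ω) (w : Ω → GeneralizedFunction d) : Prop :=
  Measurable w ∧ ∃ f : ℝ → ℂ, IsLevyExponent f ∧
    ∀ φ : TestFunction d, charFunctional P w φ = Complex.exp (∫ r, f (φ r) ∂(torusMeasure d))

end PeriodicNoise

end

noncomputable section

namespace PeriodicNoise

open scoped ENNReal

open Filter Topology

/-! ### Quadratic growth of Lévy exponents -/

/-! The noise may have no moments, so the expected Sobolev norm is of no use; one estimates instead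
the Laplace transform of its square `S`, since `exp (-c S / 2) ≤ 1_{S < ∞}` for `c > 0`. Gaussian
averaging linearises the square: for independent standard Gaussians `g_j`, independent of `w`, `E
exp (-½ ∑ ⟨w, φ_j⟩²) = E_g E_w exp (i ⟨w, ∑ g_j φ_j⟩) = E_g exp (∫ f (∑ g_j φ_j))`.

If `‖f ξ‖ ≤ η + C ξ²`, then `Re f ≤ 0` and `E g_j g_k = δ_jk` show that this differs from `1` by at
most `2 (η + C ∑ ‖φ_j‖²)`, with `L²` norms (`one_sub_integral_exp_neg_sum_sq_le`). For weighted
cosines and sines, `∑ ‖φ_j‖²` is a partial sum of `c ∑ (1 + |n|)^{2τ}`, which converges because `2τ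
< -d`. In the limit, `P (S = ∞) ≤ 2 (η + C c A)`, where `A` is the full sum of weights; fixing `η`,
hence `C`, and then taking `c` small makes this arbitrarily small.

The growth bound on `f` avoids the Lévy–Khintchine formula: `exp (f / n)` is a characteristic
function for every `n ≥ 1`, and trigonometric doubling inequalities pass to `f` in the limit
(`IsLevyExponent.exists_norm_le_add`). -/

theorem charFun_re_eq_integral_cos (ρ : Measure ℝ) [IsProbabilityMeasure ρ] (ξ : ℝ) :
    (charFun ρ ξ).re = ∫ x, Real.cos (ξ * x) ∂ρ := by
  have hi : Integrable (fun x : ℝ => Complex.exp (ξ * x * Complex.I)) ρ := by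
    refine Integrable.of_bound (by fun_prop) 1 (ae_of_all _ fun x => ?_)
    rw [← Complex.ofReal_mul, Complex.norm_exp_ofReal_mul_I]
  rw [charFun_apply_real]
  refine (integral_re (𝕜 := ℂ) hi).symm.trans (integral_congr_ae (ae_of_all _ fun x => ?_))
  simp only [RCLike.re_to_complex]
  rw [← Complex.ofReal_mul, Complex.exp_ofReal_mul_I_re]

theorem charFun_im_eq_integral_sin (ρ : Measure ℝ) [IsProbabilityMeasure ρ] (ξ : ℝ) :
    (charFun ρ ξ).im = ∫ x, Real.sin (ξ * x) ∂ρ := by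
  have hi : Integrable (fun x : ℝ => Complex.exp (ξ * x * Complex.I)) ρ := by
    refine Integrable.of_bound (by fun_prop) 1 (ae_of_all _ fun x => ?_)
    rw [← Complex.ofReal_mul, Complex.norm_exp_ofReal_mul_I]
  rw [charFun_apply_real]
  refine (integral_im (𝕜 := ℂ) hi).symm.trans (integral_congr_ae (ae_of_all _ fun x => ?_))
  simp only [RCLike.im_to_complex]
  rw [← Complex.ofReal_mul, Complex.exp_ofReal_mul_I_im]

theorem integrable_cos_mul (ρ : Measure ℝ) [IsProbabilityMeasure ρ] (ξ : ℝ) :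
    Integrable (fun x : ℝ => Real.cos (ξ * x)) ρ :=
  Integrable.of_bound (by fun_prop) 1 (ae_of_all _ fun x => Real.abs_cos_le_one _)

theorem integrable_sin_mul (ρ : Measure ℝ) [IsProbabilityMeasure ρ] (ξ : ℝ) :
    Integrable (fun x : ℝ => Real.sin (ξ * x)) ρ :=
  Integrable.of_bound (by fun_prop) 1 (ae_of_all _ fun x => Real.abs_sin_le_one _)

theorem one_sub_charFun_re_eq_integral (ρ : Measure ℝ) [IsProbabilityMeasure ρ] (ξ : ℝ) :
    1 - (charFun ρ ξ).re = ∫ x, (1 - Real.cos (ξ * x)) ∂ρ := by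
  rw [integral_sub (integrable_const _) (integrable_cos_mul ρ ξ), charFun_re_eq_integral_cos]
  simp

/-- Integrates `1 - cos 2t = 2 (1 - cos t)(1 + cos t) ≤ 4 (1 - cos t)`. The factor `4` for a doubled
argument is what produces quadratic growth. -/
theorem one_sub_charFun_re_two_mul_le (ρ : Measure ℝ) [IsProbabilityMeasure ρ] (ξ : ℝ) :
    1 - (charFun ρ (2 * ξ)).re ≤ 4 * (1 - (charFun ρ ξ).re) := by
  rw [one_sub_charFun_re_eq_integral, one_sub_charFun_re_eq_integral, ← integral_const_mul]
  refine integral_mono ((integrable_const _).sub (integrable_cos_mul ρ _))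
    (((integrable_const _).sub (integrable_cos_mul ρ _)).const_mul 4) fun x => ?_
  simp only
  rw [mul_assoc, Real.cos_two_mul]
  nlinarith [Real.cos_le_one (ξ * x), sq_nonneg (1 - Real.cos (ξ * x))]

theorem abs_charFun_im_two_mul_sub_le (ρ : Measure ℝ) [IsProbabilityMeasure ρ] (ξ : ℝ) :
    |(charFun ρ (2 * ξ)).im - 2 * (charFun ρ ξ).im| ≤ 2 * (1 - (charFun ρ ξ).re) := by
  rw [one_sub_charFun_re_eq_integral, charFun_im_eq_integral_sin, charFun_im_eq_integral_sin,
    ← integral_const_mul, ← integral_const_mul,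
    ← integral_sub (integrable_sin_mul ρ _) ((integrable_sin_mul ρ _).const_mul 2),
    ← Real.norm_eq_abs]
  refine norm_integral_le_of_norm_le
    (((integrable_const (1 : ℝ)).sub (integrable_cos_mul ρ ξ)).const_mul 2)
    (ae_of_all _ fun x => ?_)
  have h : Real.sin (2 * ξ * x) - 2 * Real.sin (ξ * x)
      = 2 * (Real.sin (ξ * x) * (Real.cos (ξ * x) - 1)) := by
    rw [mul_assoc, Real.sin_two_mul]; ring
  have h1 : 0 ≤ 1 - Real.cos (ξ * x) := sub_nonneg.2 (Real.cos_le_one _)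
  rw [h, Real.norm_eq_abs, abs_mul, abs_mul, abs_sub_comm, abs_of_nonneg h1, abs_two]
  exact mul_le_mul_of_nonneg_left
    (mul_le_of_le_one_left h1 (Real.abs_sin_le_one _)) zero_le_two

theorem continuous_charFun_real (ρ : Measure ℝ) [IsProbabilityMeasure ρ] :
    Continuous (charFun ρ) := by
  have h : charFun ρ = fun ξ : ℝ => ∫ x, Complex.exp (ξ * x * Complex.I) ∂ρ := by
    funext ξ; exact charFun_apply_real ξ
  rw [h]
  refine continuous_of_dominated (bound := fun _ => 1) (fun ξ => by fun_prop)
    (fun ξ => ae_of_all _ fun x => ?_) (integrable_const _) (ae_of_all _ fun x => by fun_prop)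
  rw [← Complex.ofReal_mul, Complex.norm_exp_ofReal_mul_I]

/-- A continuous function on `ℝ` which is an `n`-th root of `exp ∘ f` and equals `1` at `0` is
`exp (f / n)`. -/
theorem eq_exp_div_of_pow_eq_exp {f g : ℝ → ℂ} (hf : Continuous f) (hg : Continuous g)
    (hf0 : f 0 = 0) (hg0 : g 0 = 1) {n : ℕ} (hn : n ≠ 0)
    (h : ∀ ξ, g ξ ^ n = Complex.exp (f ξ)) (ξ : ℝ) : g ξ = Complex.exp (f ξ / n) := by
  have hn' : (n : ℂ) ≠ 0 := Nat.cast_ne_zero.2 hn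
  set q : ℝ → ℂ := fun ξ => g ξ * Complex.exp (-(f ξ / n)) with hq
  have hqc : Continuous q := by fun_prop
  have hqn : ∀ ξ, q ξ ^ n = 1 := fun ξ => by
    rw [hq]
    simp only
    rw [mul_pow, h, ← Complex.exp_nat_mul, ← Complex.exp_add, mul_neg, mul_div_cancel₀ _ hn',
      add_neg_cancel, Complex.exp_zero]
  have hfin : Set.Finite {z : ℂ | z ^ n = 1} := by
    refine ((Polynomial.nthRoots n (1 : ℂ)).toFinset.finite_toSet).subset fun z hz => ?_
    simpa [Polynomial.mem_nthRoots (Nat.pos_of_ne_zero hn)] using hz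
  -- A continuous map from the connected line into the finite set of `n`-th roots of unity is
  -- constant, so no branch of the root has to be chosen.
  have hsub : (Set.range q).Subsingleton :=
    hfin.countable.isTotallyDisconnected _ (Set.range_subset_iff.2 hqn)
      (isPreconnected_range hqc)
  have h1 : q ξ = 1 := by
    rw [hsub ⟨ξ, rfl⟩ ⟨0, rfl⟩]
    simp [hq, hf0, hg0]
  have h2 : g ξ = q ξ * Complex.exp (f ξ / n) := by
    rw [hq]
    simp only
    rw [mul_assoc, ← Complex.exp_add, neg_add_cancel, Complex.exp_zero, mul_one]
  rw [h2, h1, one_mul]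

theorem IsLevyExponent.exists_charFun_eq_exp_div {f : ℝ → ℂ} (hf : IsLevyExponent f) {n : ℕ}
    (hn : 1 ≤ n) :
    ∃ ρ : Measure ℝ, IsProbabilityMeasure ρ ∧ ∀ ξ, charFun ρ ξ = Complex.exp (f ξ / n) := by
  obtain ⟨hc, h0, ν, ⟨-, hdiv⟩, hν⟩ := hf
  obtain ⟨ρ, hρ, rfl⟩ := hdiv n hn
  refine ⟨ρ, hρ, eq_exp_div_of_pow_eq_exp hc (continuous_charFun_real ρ) h0 (by simp)
    (by omega) fun ξ => ?_⟩
  rw [← hν, ProbabilityTheory.charFun_map_sum_pi_eq_prod]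
  simp

/-- The derivative of `t ↦ exp (z t)` at `0`, along `t = 1 / n`. It recovers `f` from the
characteristic functions `exp (f / n)`. -/
theorem tendsto_nat_mul_exp_div_sub_one (z : ℂ) :
    Tendsto (fun n : ℕ => (n : ℂ) * (Complex.exp (z / n) - 1)) atTop (𝓝 z) := by
  have hd : HasDerivAt (fun t : ℝ => Complex.exp (z * t)) z 0 := by
    have := (((hasDerivAt_id (0 : ℝ)).ofReal_comp).const_mul z).cexp
    simpa using this
  have ht : Tendsto (fun n : ℕ => ((n : ℝ))⁻¹) atTop (𝓝[>] 0) :=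
    tendsto_inv_atTop_nhdsGT_zero.comp tendsto_natCast_atTop_atTop
  refine (hd.tendsto_slope_zero_right.comp ht).congr fun n => ?_
  simp [div_eq_mul_inv]

theorem IsLevyExponent.re_nonpos {f : ℝ → ℂ} (hf : IsLevyExponent f) (ξ : ℝ) :
    (f ξ).re ≤ 0 := by
  obtain ⟨-, -, ν, ⟨hp, -⟩, hν⟩ := hf
  have := norm_charFun_le_one (μ := ν) ξ
  rwa [hν, Complex.norm_exp, Real.exp_le_one_iff] at this

theorem tendsto_nat_mul_one_sub_exp_div_re {f : ℝ → ℂ} (ξ : ℝ) :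
    Tendsto (fun n : ℕ => (n : ℝ) * (1 - (Complex.exp (f ξ / n)).re)) atTop (𝓝 (-(f ξ).re)) := by
  have := ((Complex.continuous_re.tendsto _).comp (tendsto_nat_mul_exp_div_sub_one (f ξ))).neg
  refine this.congr fun n => ?_
  simp
  ring

theorem tendsto_nat_mul_exp_div_im {f : ℝ → ℂ} (ξ : ℝ) :
    Tendsto (fun n : ℕ => (n : ℝ) * (Complex.exp (f ξ / n)).im) atTop (𝓝 (f ξ).im) := by
  have := (Complex.continuous_im.tendsto _).comp (tendsto_nat_mul_exp_div_sub_one (f ξ))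
  refine this.congr fun n => ?_
  simp

theorem IsLevyExponent.neg_re_two_mul_le {f : ℝ → ℂ} (hf : IsLevyExponent f) (ξ : ℝ) :
    -(f (2 * ξ)).re ≤ 4 * -(f ξ).re := by
  refine le_of_tendsto_of_tendsto (tendsto_nat_mul_one_sub_exp_div_re (2 * ξ))
    ((tendsto_nat_mul_one_sub_exp_div_re ξ).const_mul 4) ?_
  filter_upwards [eventually_ge_atTop 1] with n hn
  obtain ⟨ρ, hρ, h⟩ := hf.exists_charFun_eq_exp_div hn
  rw [← h, ← h, mul_left_comm]
  exact mul_le_mul_of_nonneg_left (one_sub_charFun_re_two_mul_le ρ ξ) n.cast_nonneg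

theorem IsLevyExponent.abs_im_two_mul_sub_le {f : ℝ → ℂ} (hf : IsLevyExponent f) (ξ : ℝ) :
    |(f (2 * ξ)).im - 2 * (f ξ).im| ≤ 2 * -(f ξ).re := by
  refine le_of_tendsto_of_tendsto
    (((tendsto_nat_mul_exp_div_im (2 * ξ)).sub ((tendsto_nat_mul_exp_div_im ξ).const_mul 2)).abs)
    ((tendsto_nat_mul_one_sub_exp_div_re ξ).const_mul 2) ?_
  filter_upwards [eventually_ge_atTop 1] with n hn
  obtain ⟨ρ, hρ, h⟩ := hf.exists_charFun_eq_exp_div hn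
  rw [← h, ← h, mul_left_comm, mul_left_comm 2, ← mul_sub, abs_mul, Nat.abs_cast]
  exact mul_le_mul_of_nonneg_left (abs_charFun_im_two_mul_sub_le ρ ξ) n.cast_nonneg

/-- Each doubling of the argument multiplies the bound by `4`, so a bound on a compact interval
spreads to quadratic growth. -/
theorem IsLevyExponent.exists_norm_le {f : ℝ → ℂ} (hf : IsLevyExponent f) :
    ∃ C : ℝ, 0 ≤ C ∧ ∀ ξ, 1 ≤ |ξ| → ‖f ξ‖ ≤ C * ξ ^ 2 := by
  obtain ⟨K, hK⟩ := (isCompact_Icc (a := (-2 : ℝ)) (b := 2)).exists_bound_of_continuousOn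
    hf.1.continuousOn
  have hK0 : 0 ≤ K := (norm_nonneg _).trans (hK 0 (by norm_num))
  have key : ∀ (k : ℕ) (ξ : ℝ), |ξ| ≤ 2 →
      -(f (2 ^ k * ξ)).re ≤ K * 4 ^ k ∧ |(f (2 ^ k * ξ)).im| ≤ K * 4 ^ k := by
    intro k ξ hξ
    induction k with
    | zero =>
      have h := hK ξ (abs_le.1 hξ)
      simp only [pow_zero, one_mul, mul_one]
      exact ⟨(neg_le_abs _).trans ((Complex.abs_re_le_norm _).trans h),
        (Complex.abs_im_le_norm _).trans h⟩
    | succ k ih =>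
      have h1 := hf.neg_re_two_mul_le (2 ^ k * ξ)
      have h2 := abs_le.1 (hf.abs_im_two_mul_sub_le (2 ^ k * ξ))
      have h3 := abs_le.1 ih.2
      have e : (2 : ℝ) ^ (k + 1) * ξ = 2 * (2 ^ k * ξ) := by ring
      rw [e, pow_succ]
      -- For the imaginary part, `2 · K 4^k` from doubling and `2 · K 4^k` from the real part add up
      -- to `K 4^(k+1)`.
      exact ⟨by linarith [ih.1], abs_le.2 ⟨by linarith [ih.1], by linarith [ih.1]⟩⟩
  refine ⟨2 * K, by positivity, fun ξ hξ => ?_⟩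
  -- `2^k ≤ |ξ| < 2^(k+1)`, so `ξ / 2^k` lies in the interval `[-2, 2]` where `K` bounds `f`.
  obtain ⟨k, hk1, hk2⟩ := exists_nat_pow_near hξ (one_lt_two)
  have hpos : (0 : ℝ) < 2 ^ k := by positivity
  have h := key k (ξ / 2 ^ k) (by
    rw [abs_div, abs_of_pos hpos, div_le_iff₀ hpos, ← pow_succ']
    exact hk2.le)
  rw [mul_div_cancel₀ _ hpos.ne'] at h
  have h4 : (4 : ℝ) ^ k ≤ ξ ^ 2 := by
    rw [show (4 : ℝ) = 2 ^ 2 by norm_num, ← pow_mul, mul_comm, pow_mul, ← sq_abs ξ]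
    exact pow_le_pow_left₀ hpos.le hk1 2
  have hre : |(f ξ).re| ≤ K * 4 ^ k := by
    rw [abs_of_nonpos (hf.re_nonpos ξ)]; exact h.1
  calc ‖f ξ‖ ≤ |(f ξ).re| + |(f ξ).im| := Complex.norm_le_abs_re_add_abs_im _
    _ ≤ 2 * K * 4 ^ k := by linarith [h.2]
    _ ≤ 2 * K * ξ ^ 2 := mul_le_mul_of_nonneg_left h4 (by positivity)

/-- Near `0`, `f` need not be `O(ξ²)` (a drift is linear there), but continuity makes it smaller
than `η`. Away from `0` everything is absorbed into `C ξ²`, with `C` depending on `η`. -/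
theorem IsLevyExponent.exists_norm_le_add {f : ℝ → ℂ} (hf : IsLevyExponent f) {η : ℝ}
    (hη : 0 < η) : ∃ C : ℝ, 0 ≤ C ∧ ∀ ξ, ‖f ξ‖ ≤ η + C * ξ ^ 2 := by
  obtain ⟨C, hC, h⟩ := hf.exists_norm_le
  obtain ⟨K, hK⟩ := (isCompact_Icc (a := (-1 : ℝ)) (b := 1)).exists_bound_of_continuousOn
    hf.1.continuousOn
  have hK0 : 0 ≤ K := (norm_nonneg _).trans (hK 0 (by norm_num))
  obtain ⟨r, hr, hball⟩ := Metric.continuousAt_iff.1 (hf.1.continuousAt (x := 0)) η hη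
  refine ⟨C + K / r ^ 2, by positivity, fun ξ => ?_⟩
  have hKr : 0 ≤ K / r ^ 2 * ξ ^ 2 := by positivity
  have hCξ : 0 ≤ C * ξ ^ 2 := by positivity
  rw [add_mul]
  rcases le_total 1 |ξ| with h1 | h1
  · linarith [h ξ h1]
  rcases lt_or_ge |ξ| r with h2 | h2
  · have h3 := hball (x := ξ) (by simpa using h2)
    rw [hf.2.1, dist_zero_right] at h3
    linarith
  · have h3 : r ^ 2 ≤ ξ ^ 2 := by
      rw [← sq_abs ξ]; exact pow_le_pow_left₀ hr.le h2 2
    have h4 : K ≤ K / r ^ 2 * ξ ^ 2 := by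
      rw [div_mul_eq_mul_div, le_div_iff₀ (by positivity)]
      exact mul_le_mul_of_nonneg_left h3 hK0
    linarith [hK ξ (abs_le.1 h1)]

/-! ### Summability of the Sobolev weights -/

theorem summable_one_add_abs_int_rpow {b : ℝ} (hb : 1 < b) :
    Summable fun k : ℤ => (1 + |(k : ℝ)|) ^ (-b) := by
  refine Summable.of_norm_bounded_eventually (Real.summable_abs_int_rpow hb) ?_
  -- The comparison fails only at `k = 0`, where `0 ^ (-b) = 0` by convention.
  refine (Set.finite_singleton (0 : ℤ)).subset fun k hk => ?_
  by_contra hk0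
  refine hk ?_
  have hpos : 0 < |(k : ℝ)| := abs_pos.2 (Int.cast_ne_zero.2 hk0)
  change ‖_‖ ≤ _
  rw [Real.norm_of_nonneg (by positivity)]
  exact Real.rpow_le_rpow_of_nonpos hpos (by linarith) (by linarith)

/-- A finite set of multi-indices lies in a box, over which the sum factors. -/
theorem summable_prod_apply {ι κ : Type*} [Fintype ι] {p : κ → ℝ} (hp : Summable p)
    (hp0 : ∀ k, 0 ≤ p k) : Summable fun n : ι → κ => ∏ i, p (n i) := by
  classical
  refine summable_of_sum_le (c := ∏ _i : ι, ∑' k, p k)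
    (fun n => Finset.prod_nonneg fun i _ => hp0 _) fun s => ?_
  have hs : s ⊆ Fintype.piFinset fun i => s.image fun n => n i := fun n hn =>
    Fintype.mem_piFinset.2 fun i => Finset.mem_image_of_mem (fun n : ι → κ => n i) hn
  refine (Finset.sum_le_sum_of_subset_of_nonneg hs
    fun n _ _ => Finset.prod_nonneg fun i _ => hp0 _).trans ?_
  rw [← Finset.prod_univ_sum (fun i => s.image fun n => n i) (fun _ k => p k)]
  exact Finset.prod_le_prod (fun i _ => Finset.sum_nonneg fun k _ => hp0 k)
    fun i _ => hp.sum_le_tsum _ fun k _ => hp0 k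

/-- As `|n_i| ≤ |n|`, splitting the exponent evenly gives `(1 + |n|)^s ≤ ∏ (1 + |n_i|)^(s/d)`, and
`s/d < -1` reduces to dimension one. -/
theorem summable_one_add_latticeNorm_rpow (d : ℕ) {s : ℝ} (hs : s < -d) :
    Summable fun n : Fin d → ℤ => (1 + latticeNorm n) ^ s := by
  rcases Nat.eq_zero_or_pos d with rfl | hd
  · exact Summable.of_finite
  have hd' : (0 : ℝ) < d := Nat.cast_pos.2 hd
  have hb : 1 < -s / d := by rw [lt_div_iff₀ hd']; linarith
  have hle : ∀ (n : Fin d → ℤ) (i : Fin d), |(n i : ℝ)| ≤ latticeNorm n := fun n i => by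
    refine Real.le_sqrt_of_sq_le ?_
    rw [sq_abs]
    exact Finset.single_le_sum (f := fun i => (n i : ℝ) ^ 2) (fun j _ => sq_nonneg _)
      (Finset.mem_univ i)
  have hn0 : ∀ n : Fin d → ℤ, 0 ≤ latticeNorm n := fun n => Real.sqrt_nonneg _
  refine Summable.of_nonneg_of_le (fun n => ?_) (fun n => ?_)
    (summable_prod_apply (ι := Fin d) (summable_one_add_abs_int_rpow hb) fun k => by positivity)
  · have := hn0 n
    positivity
  · have e : (1 + latticeNorm n) ^ s = ∏ _i : Fin d, (1 + latticeNorm n) ^ (-(-s / d)) := by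
      have := hn0 n
      rw [Finset.prod_const, Finset.card_univ, Fintype.card_fin, ← Real.rpow_mul_natCast
        (by positivity)]
      congr 1
      field_simp
    rw [e]
    refine Finset.prod_le_prod (fun i _ => by have := hn0 n; positivity) fun i _ => ?_
    exact Real.rpow_le_rpow_of_nonpos (by positivity) (by linarith [hle n i]) (by linarith)

/-! ### Gaussian averaging -/

/-- The standard Gaussian measure on `ℝ^J`. -/
def gaussianPi (J : Type*) [Fintype J] : Measure (J → ℝ) :=
  Measure.pi fun _ => ProbabilityTheory.gaussianReal 0 1

section Gaussian

open ProbabilityTheory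

variable {J : Type*} [Fintype J]

instance : IsProbabilityMeasure (gaussianPi J) := by
  unfold gaussianPi; infer_instance

theorem integral_cexp_gaussianPi (x : J → ℝ) :
    ∫ g, Complex.exp (Complex.I * ((∑ j, g j * x j : ℝ) : ℂ)) ∂(gaussianPi J)
      = ((Real.exp (-(∑ j, x j ^ 2) / 2) : ℝ) : ℂ) := by
  have h : ∀ g : J → ℝ, Complex.exp (Complex.I * ((∑ j, g j * x j : ℝ) : ℂ))
      = ∏ j, Complex.exp (x j * g j * Complex.I) := fun g => by
    rw [← Complex.exp_sum, Complex.ofReal_sum, Finset.mul_sum]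
    congr 1
    refine Finset.sum_congr rfl fun j _ => ?_
    push_cast
    ring
  simp_rw [h]
  rw [gaussianPi, integral_fintype_prod_eq_prod
    (f := fun j (y : ℝ) => Complex.exp (x j * y * Complex.I))]
  simp_rw [← charFun_apply_real, charFun_gaussianReal]
  rw [← Complex.exp_sum, Complex.ofReal_exp]
  congr 1
  push_cast
  rw [← Finset.sum_neg_distrib, Finset.sum_div]
  refine Finset.sum_congr rfl fun j _ => ?_
  simp
  ring

theorem measurePreserving_eval_gaussianPi (j : J) :
    MeasurePreserving (fun g : J → ℝ => g j) (gaussianPi J) (gaussianReal 0 1) :=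
  measurePreserving_eval (fun _ : J => gaussianReal 0 1) j

theorem memLp_two_eval_gaussianPi (j : J) : MemLp (fun g : J → ℝ => g j) 2 (gaussianPi J) :=
  (memLp_id_gaussianReal (μ := 0) (v := 1) 2).comp_measurePreserving
    (measurePreserving_eval_gaussianPi j)

theorem integral_eval_gaussianPi (j : J) : ∫ g, g j ∂(gaussianPi J) = 0 := by
  have h := (measurePreserving_eval_gaussianPi j).hasLaw.integral_eq
  rw [h]
  exact integral_id_gaussianReal

theorem integral_sq_eval_gaussianPi (j : J) : ∫ g, g j * g j ∂(gaussianPi J) = 1 := by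
  have h := (measurePreserving_eval_gaussianPi j).hasLaw.variance_eq
  rw [variance_id_gaussianReal, variance_eq_sub (memLp_two_eval_gaussianPi j),
    integral_eval_gaussianPi] at h
  simpa [pow_two] using h

theorem integral_mul_eval_gaussianPi [DecidableEq J] (j k : J) :
    ∫ g, g j * g k ∂(gaussianPi J) = if j = k then 1 else 0 := by
  split_ifs with hjk
  · subst hjk
    exact integral_sq_eval_gaussianPi j
  · have hind : IndepFun (fun g : J → ℝ => g j) (fun g => g k) (gaussianPi J) :=
      (iIndepFun_pi (μ := fun _ : J => gaussianReal 0 1) (X := fun _ x => x)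
        fun _ => aemeasurable_id).indepFun hjk
    have h := hind.integral_fun_mul_eq_mul_integral
      (measurable_pi_apply j).aestronglyMeasurable (measurable_pi_apply k).aestronglyMeasurable
    rw [h, integral_eval_gaussianPi, zero_mul]

theorem integrable_mul_eval_gaussianPi (j k : J) :
    Integrable (fun g : J → ℝ => g j * g k) (gaussianPi J) :=
  (memLp_two_eval_gaussianPi j).integrable_mul (memLp_two_eval_gaussianPi k)

variable {α : Type*} [MeasurableSpace α] {μ : Measure α} {φ : J → α → ℝ}

theorem integral_sq_sum_mul (hφ : ∀ j k, Integrable (fun r => φ j r * φ k r) μ) (g : J → ℝ) :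
    ∫ r, (∑ j, g j * φ j r) ^ 2 ∂μ = ∑ j, ∑ k, g j * g k * ∫ r, φ j r * φ k r ∂μ := by
  have h : ∀ r, (∑ j, g j * φ j r) ^ 2 = ∑ j, ∑ k, g j * g k * (φ j r * φ k r) := fun r => by
    rw [pow_two, Finset.sum_mul_sum]
    refine Finset.sum_congr rfl fun j _ => Finset.sum_congr rfl fun k _ => by ring
  simp_rw [h]
  rw [integral_finsetSum _ fun j _ => integrable_finsetSum _ fun k _ => (hφ j k).const_mul _]
  refine Finset.sum_congr rfl fun j _ => ?_
  rw [integral_finsetSum _ fun k _ => (hφ j k).const_mul _]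
  exact Finset.sum_congr rfl fun k _ => integral_const_mul _ _

theorem integrable_integral_sq_sum_mul (hφ : ∀ j k, Integrable (fun r => φ j r * φ k r) μ) :
    Integrable (fun g : J → ℝ => ∫ r, (∑ j, g j * φ j r) ^ 2 ∂μ) (gaussianPi J) := by
  simp_rw [integral_sq_sum_mul hφ]
  exact integrable_finsetSum _ fun j _ => integrable_finsetSum _ fun k _ =>
    (integrable_mul_eval_gaussianPi j k).mul_const _

/-- The Gaussian covariance is the identity, so only diagonal terms survive. -/
theorem integral_integral_sq_sum_mul (hφ : ∀ j k, Integrable (fun r => φ j r * φ k r) μ) :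
    ∫ g, (∫ r, (∑ j, g j * φ j r) ^ 2 ∂μ) ∂(gaussianPi J) = ∑ j, ∫ r, φ j r * φ j r ∂μ := by
  classical
  simp_rw [integral_sq_sum_mul hφ]
  rw [integral_finsetSum _ fun j _ => integrable_finsetSum _ fun k _ =>
    (integrable_mul_eval_gaussianPi j k).mul_const _]
  refine Finset.sum_congr rfl fun j _ => ?_
  rw [integral_finsetSum _ fun k _ => (integrable_mul_eval_gaussianPi j k).mul_const _]
  simp_rw [integral_mul_const, integral_mul_eval_gaussianPi]
  simp

end Gaussian

/-! ### The noise tested against finitely many test functions -/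

instance (d : ℕ) : IsProbabilityMeasure (torusMeasure d) := by
  unfold torusMeasure; infer_instance

theorem measurable_eval {d : ℕ} (φ : TestFunction d) :
    Measurable fun u : GeneralizedFunction d => u φ := by
  intro B hB
  refine MeasurableSpace.measurableSet_generateFrom ⟨1, fun _ => φ, (fun x => x 0) ⁻¹' B,
    measurable_pi_apply 0 hB, rfl⟩

theorem norm_one_sub_exp_le {z : ℂ} (hz : z.re ≤ 0) : ‖1 - Complex.exp z‖ ≤ 2 * ‖z‖ := by
  rw [norm_sub_rev]
  rcases le_total ‖z‖ 1 with h | h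
  · exact Complex.norm_exp_sub_one_le h
  · have h1 : ‖Complex.exp z‖ ≤ 1 := by rwa [Complex.norm_exp, Real.exp_le_one_iff]
    calc ‖Complex.exp z - 1‖ ≤ ‖Complex.exp z‖ + ‖(1 : ℂ)‖ := norm_sub_le _ _
      _ ≤ 2 * ‖z‖ := by rw [norm_one]; linarith

theorem integrable_of_continuous_torus {d : ℕ} {E : Type*} [NormedAddCommGroup E]
    {h : UnitAddTorus (Fin d) → E} (hh : Continuous h) : Integrable h (torusMeasure d) := by
  obtain ⟨C, hC⟩ := isCompact_univ.exists_bound_of_continuousOn hh.continuousOn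
  exact Integrable.of_bound
    (hh.stronglyMeasurable_of_hasCompactSupport
      (HasCompactSupport.of_compactSpace h)).aestronglyMeasurable C
    (ae_of_all _ fun x => hC x trivial)

variable {d : ℕ} {Ω : Type*} [MeasurableSpace Ω]

theorem charFunctional_eq_integral {P : Measure Ω} {w : Ω → GeneralizedFunction d}
    (hw : Measurable w) (φ : TestFunction d) :
    charFunctional P w φ = ∫ ω, Complex.exp (Complex.I * (w ω φ : ℂ)) ∂P := by
  exact integral_map hw.aemeasurable (Complex.measurable_exp.comp
    ((Complex.measurable_ofReal.comp (measurable_eval φ)).const_mul _)).aestronglyMeasurable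

theorem TestFunction.sum_smul_apply {J : Type*} [Fintype J] (g : J → ℝ) (φ : J → TestFunction d)
    (x : UnitAddTorus (Fin d)) : (∑ j, g j • φ j : TestFunction d) x = ∑ j, g j * φ j x := by
  classical
  have h : ∀ s : Finset J, (∑ j ∈ s, g j • φ j : TestFunction d) x = ∑ j ∈ s, g j * φ j x := by
    intro s
    induction s using Finset.induction_on with
    | empty => rfl
    | insert j s hj ih =>
      rw [Finset.sum_insert hj, Finset.sum_insert hj, add_apply, smul_apply, ih]
  exact h _

/-- If the Lévy exponent satisfies `‖f ξ‖ ≤ η + C ξ²`, the Gaussian transform of the noise tested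
against finitely many test functions is close to `1`. -/
theorem one_sub_integral_exp_neg_sum_sq_le {P : Measure Ω} [IsProbabilityMeasure P]
    {w : Ω → GeneralizedFunction d} (hw : Measurable w) {f : ℝ → ℂ} (hf : IsLevyExponent f)
    (hwf : ∀ φ : TestFunction d,
      charFunctional P w φ = Complex.exp (∫ r, f (φ r) ∂(torusMeasure d)))
    {η C : ℝ} (hfb : ∀ ξ, ‖f ξ‖ ≤ η + C * ξ ^ 2) {J : Type*} [Fintype J]
    (φ : J → TestFunction d) (hφ : ∀ j, Continuous (φ j)) :
    1 - ∫ ω, Real.exp (-(∑ j, w ω (φ j) ^ 2) / 2) ∂P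
      ≤ 2 * (η + C * ∑ j, ∫ r, φ j r * φ j r ∂(torusMeasure d)) := by
  have hev : ∀ j, Measurable fun ω => w ω (φ j) := fun j => (measurable_eval (φ j)).comp hw
  have hprod : Integrable (Function.uncurry fun (ω : Ω) (g : J → ℝ) =>
      Complex.exp (Complex.I * ((∑ j, g j * w ω (φ j) : ℝ) : ℂ))) (P.prod (gaussianPi J)) := by
    refine Integrable.of_bound (Measurable.aestronglyMeasurable ?_) 1 (ae_of_all _ fun x => ?_)
    · have h : Measurable fun x : Ω × (J → ℝ) => ∑ j, x.2 j * w x.1 (φ j) :=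
        Finset.measurable_sum _ fun j _ =>
          ((measurable_pi_apply j).comp measurable_snd).mul ((hev j).comp measurable_fst)
      exact Complex.measurable_exp.comp
        ((Complex.measurable_ofReal.comp h).const_mul Complex.I)
    · rw [Function.uncurry, mul_comm, Complex.norm_exp_ofReal_mul_I]
  have hchar : ∀ g : J → ℝ, ∫ ω, Complex.exp (Complex.I * ((∑ j, g j * w ω (φ j) : ℝ) : ℂ)) ∂P
      = Complex.exp (∫ r, f (∑ j, g j * φ j r) ∂(torusMeasure d)) := fun g => by
    have h := hwf (∑ j, g j • φ j)
    rw [charFunctional_eq_integral hw] at h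
    simpa [TestFunction.sum_smul_apply] using h
  -- Fubini: integrating over `g` first gives the Gaussian transform of the noise, over `ω` first
  -- its characteristic functional.
  have hswap := integral_integral_swap hprod
  simp_rw [integral_cexp_gaussianPi, hchar] at hswap
  have hint := hprod.integral_prod_right
  simp only [Function.uncurry, hchar] at hint
  have hφφ : ∀ j k, Integrable (fun r => φ j r * φ k r) (torusMeasure d) := fun j k =>
    integrable_of_continuous_torus ((hφ j).mul (hφ k))
  have hpt : ∀ g : J → ℝ, ‖1 - Complex.exp (∫ r, f (∑ j, g j * φ j r) ∂(torusMeasure d))‖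
      ≤ 2 * (η + C * ∫ r, (∑ j, g j * φ j r) ^ 2 ∂(torusMeasure d)) := fun g => by
    have hc : Continuous fun r => ∑ j, g j * φ j r :=
      continuous_finsetSum _ fun j _ => continuous_const.mul (hφ j)
    have hfi : Integrable (fun r => f (∑ j, g j * φ j r)) (torusMeasure d) :=
      integrable_of_continuous_torus (hf.1.comp hc)
    have hsq : Integrable (fun r => C * (∑ j, g j * φ j r) ^ 2) (torusMeasure d) :=
      integrable_of_continuous_torus (by fun_prop)
    refine (norm_one_sub_exp_le ?_).trans (mul_le_mul_of_nonneg_left ?_ zero_le_two)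
    · have h := integral_re (𝕜 := ℂ) hfi
      simp only [RCLike.re_to_complex] at h
      rw [← h]
      exact integral_nonpos fun r => hf.re_nonpos _
    · refine (norm_integral_le_of_norm_le ((integrable_const η).add hsq)
        (ae_of_all _ fun r => hfb _)).trans_eq ?_
      simp only [Pi.add_apply]
      rw [integral_add (integrable_const _) hsq, integral_const_mul]
      simp
  have hI := integrable_integral_sq_sum_mul (μ := torusMeasure d) (φ := fun j r => φ j r) hφφ
  have hmain := norm_integral_le_of_norm_le
    (((integrable_const η).add (hI.const_mul C)).const_mul 2) (ae_of_all _ hpt)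
  simp only [Pi.add_apply] at hmain
  rw [integral_sub (integrable_const _) hint, ← hswap, integral_const_mul,
    integral_add (integrable_const _) (hI.const_mul C), integral_const_mul,
    integral_integral_sq_sum_mul (μ := torusMeasure d) (φ := fun j r => φ j r) hφφ,
    integral_complex_ofReal] at hmain
  simp only [integral_const, probReal_univ, one_smul] at hmain
  rw [← Complex.ofReal_one, ← Complex.ofReal_sub, Complex.norm_real] at hmain
  exact (le_abs_self _).trans hmain

/-! ### Almost sure Sobolev regularity -/

theorem continuous_expRe (n : Fin d → ℤ) : Continuous (expRe n) :=
  Complex.continuous_re.comp (UnitAddTorus.mFourier n).continuous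

theorem continuous_expIm (n : Fin d → ℤ) : Continuous (expIm n) :=
  Complex.continuous_im.comp (UnitAddTorus.mFourier n).continuous

theorem expRe_mul_self_add_expIm_mul_self (n : Fin d → ℤ) (x : UnitAddTorus (Fin d)) :
    expRe n x * expRe n x + expIm n x * expIm n x = 1 := by
  rw [expRe_apply, expIm_apply, ← Complex.normSq_apply, Complex.normSq_eq_norm_sq]
  simp [UnitAddTorus.mFourier, norm_prod, Circle.norm_coe]

theorem norm_fourierCoefficient_sq (u : GeneralizedFunction d) (n : Fin d → ℤ) :
    ‖fourierCoefficient u n‖ ^ 2 = u (expRe (-n)) ^ 2 + u (expIm (-n)) ^ 2 := by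
  rw [← Complex.normSq_eq_norm_sq, Complex.normSq_apply, fourierCoefficient]
  simp
  ring

/-- The square of the `H_2^τ` norm, with values in `[0, ∞]`. -/
def sobolevSum (τ : ℝ) (u : GeneralizedFunction d) : ℝ≥0∞ :=
  ∑' n : Fin d → ℤ,
    ENNReal.ofReal ((1 + latticeNorm n) ^ (2 * τ) * ‖fourierCoefficient u n‖ ^ 2)

theorem mem_sobolevSpace_iff {τ : ℝ} {u : GeneralizedFunction d} :
    u ∈ sobolevSpace d τ ↔ sobolevSum τ u < ⊤ :=
  ENNReal.rpow_lt_top_iff_of_pos (by norm_num)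

theorem measurable_sobolevSum (τ : ℝ) : Measurable (sobolevSum (d := d) τ) := by
  refine Measurable.tsum fun n => ENNReal.measurable_ofReal.comp ?_
  simp_rw [norm_fourierCoefficient_sq]
  exact (((measurable_eval _).pow_const 2).add ((measurable_eval _).pow_const 2)).const_mul _

theorem measurableSet_sobolevSpace (τ : ℝ) : MeasurableSet (sobolevSpace d τ) := by
  have h : sobolevSpace d τ = sobolevSum τ ⁻¹' Set.Iio ⊤ := Set.ext fun _ => mem_sobolevSpace_iff
  rw [h]
  exact measurable_sobolevSum τ measurableSet_Iio

/-- `x ↦ exp (-x)` on `[0, ∞]`, with `exp (-∞) = 0`. -/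
def expNeg (x : ℝ≥0∞) : ℝ := if x = ⊤ then 0 else Real.exp (-x.toReal)

theorem tendsto_exp_neg_expNeg {β : Type*} {l : Filter β} {g : β → ℝ} {x : ℝ≥0∞}
    (hg : ∀ b, 0 ≤ g b) (h : Tendsto (fun b => ENNReal.ofReal (g b)) l (𝓝 x)) :
    Tendsto (fun b => Real.exp (-g b)) l (𝓝 (expNeg x)) := by
  unfold expNeg
  split_ifs with hx
  · subst hx
    exact Real.tendsto_exp_neg_atTop_nhds_zero.comp (ENNReal.tendsto_ofReal_nhds_top.1 h)
  · have h1 := (ENNReal.tendsto_toReal hx).comp h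
    refine (Real.continuous_exp.tendsto _).comp (h1.neg.congr fun b => ?_)
    simp [ENNReal.toReal_ofReal (hg b)]

/-- For `c ≠ 0`, `S b = ⊤` forces `c * S b = ⊤`, where `expNeg` vanishes; elsewhere it is at most
`1`. -/
theorem expNeg_le_indicator {β : Type*} (S : β → ℝ≥0∞) (c : ℝ≥0∞) (hc : c ≠ 0) (b : β) :
    expNeg (c * S b) ≤ Set.indicator {b | S b < ⊤} (fun _ => (1 : ℝ)) b := by
  unfold expNeg
  split_ifs with h
  · exact Set.indicator_nonneg (fun _ _ => zero_le_one) b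
  · have hS : S b < ⊤ := lt_top_iff_ne_top.2 fun hS => h (by rw [hS, ENNReal.mul_top hc])
    rw [Set.indicator_of_mem (show b ∈ {b | S b < ⊤} from hS), Real.exp_le_one_iff]
    exact neg_nonpos.2 ENNReal.toReal_nonneg

theorem one_sub_integral_exp_neg_partial_sobolevSum_le {P : Measure Ω} [IsProbabilityMeasure P]
    {w : Ω → GeneralizedFunction d} (hw : Measurable w) {f : ℝ → ℂ} (hf : IsLevyExponent f)
    (hwf : ∀ φ : TestFunction d,
      charFunctional P w φ = Complex.exp (∫ r, f (φ r) ∂(torusMeasure d)))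
    {η C : ℝ} (hfb : ∀ ξ, ‖f ξ‖ ≤ η + C * ξ ^ 2) {a : (Fin d → ℤ) → ℝ} (ha : ∀ n, 0 ≤ a n)
    (s : Finset (Fin d → ℤ)) :
    1 - ∫ ω, Real.exp (-((∑ n ∈ s, a n * ‖fourierCoefficient (w ω) n‖ ^ 2) / 2)) ∂P
      ≤ 2 * (η + C * ∑ n ∈ s, a n) := by
  -- Cosine and sine at each frequency, scaled by `√a_n`: their squared pairings add up to `a_n
  -- |û(n)|²`, and `cos² + sin² = 1` makes their squared `L²` norms add up to `a_n`.
  let φ : s ⊕ s → TestFunction d := Sum.elim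
    (fun n => Real.sqrt (a n) • expRe (-n.1)) (fun n => Real.sqrt (a n) • expIm (-n.1))
  have hφ : ∀ j, Continuous (φ j) := by
    rintro (n | n)
    · exact continuous_const.mul (continuous_expRe _)
    · exact continuous_const.mul (continuous_expIm _)
  have h := one_sub_integral_exp_neg_sum_sq_le hw hf hwf hfb φ hφ
  have e1 : ∀ ω, ∑ j, w ω (φ j) ^ 2 = ∑ n ∈ s, a n * ‖fourierCoefficient (w ω) n‖ ^ 2 := by
    intro ω
    rw [Fintype.sum_sum_type, ← Finset.sum_add_distrib, ← Finset.sum_coe_sort s]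
    refine Finset.sum_congr rfl fun n _ => ?_
    simp only [φ, Sum.elim_inl, Sum.elim_inr, map_smul, smul_eq_mul, mul_pow,
      Real.sq_sqrt (ha n), norm_fourierCoefficient_sq]
    ring
  have e2 : ∑ j, ∫ r, φ j r * φ j r ∂(torusMeasure d) = ∑ n ∈ s, a n := by
    have hi : ∀ j, Integrable (fun r => φ j r * φ j r) (torusMeasure d) := fun j =>
      integrable_of_continuous_torus ((hφ j).mul (hφ j))
    rw [Fintype.sum_sum_type, ← Finset.sum_add_distrib, ← Finset.sum_coe_sort s]
    refine Finset.sum_congr rfl fun n _ => ?_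
    rw [← integral_add (hi _) (hi _)]
    have : ∀ r, φ (Sum.inl n) r * φ (Sum.inl n) r + φ (Sum.inr n) r * φ (Sum.inr n) r = a n := by
      intro r
      simp only [φ, Sum.elim_inl, Sum.elim_inr, TestFunction.smul_apply]
      calc _ = Real.sqrt (a n) ^ 2 * (expRe (-n.1) r * expRe (-n.1) r
            + expIm (-n.1) r * expIm (-n.1) r) := by ring
        _ = a n := by rw [expRe_mul_self_add_expIm_mul_self, Real.sq_sqrt (ha n), mul_one]
    simp [this]
  simp_rw [e1, e2, neg_div] at h
  exact h

/-- The finite bound is uniform in the set of frequencies. Letting that set exhaust `ℤ^d`, dominated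
convergence bounds `1 - E exp (-c S / 2)`, which dominates `P (S = ∞)`. -/
theorem one_sub_measureReal_sobolevSpace_le {P : Measure Ω} [IsProbabilityMeasure P]
    {w : Ω → GeneralizedFunction d} (hw : Measurable w) {f : ℝ → ℂ} (hf : IsLevyExponent f)
    (hwf : ∀ φ : TestFunction d,
      charFunctional P w φ = Complex.exp (∫ r, f (φ r) ∂(torusMeasure d)))
    {η C : ℝ} (hC : 0 ≤ C) (hfb : ∀ ξ, ‖f ξ‖ ≤ η + C * ξ ^ 2) {τ : ℝ}
    (hτ : Summable fun n : Fin d → ℤ => (1 + latticeNorm n) ^ (2 * τ)) {c : ℝ} (hc : 0 < c) :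
    1 - P.real {ω | w ω ∈ sobolevSpace d τ}
      ≤ 2 * (η + C * (c * ∑' n : Fin d → ℤ, (1 + latticeNorm n) ^ (2 * τ))) := by
  set b : (Fin d → ℤ) → ℝ := fun n => (1 + latticeNorm n) ^ (2 * τ)
  have hb : ∀ n, 0 ≤ b n := fun n =>
    Real.rpow_nonneg (add_nonneg zero_le_one (Real.sqrt_nonneg _)) _
  let S : Ω → ℝ≥0∞ := fun ω => sobolevSum τ (w ω)
  have hS : Measurable S := (measurable_sobolevSum τ).comp hw
  let T : Finset (Fin d → ℤ) → Ω → ℝ := fun s ω =>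
    (∑ n ∈ s, c * b n * ‖fourierCoefficient (w ω) n‖ ^ 2) / 2
  have hT0 : ∀ s ω, 0 ≤ T s ω := fun s ω => div_nonneg (Finset.sum_nonneg fun n _ =>
    mul_nonneg (mul_nonneg hc.le (hb n)) (sq_nonneg _)) zero_le_two
  have hTmeas : ∀ s, Measurable (T s) := fun s => by
    refine (Finset.measurable_sum _ fun n _ => Measurable.const_mul ?_ _).div_const 2
    simp_rw [norm_fourierCoefficient_sq]
    exact (((measurable_eval _).comp hw).pow_const 2).add
      (((measurable_eval _).comp hw).pow_const 2)
  have hlim : ∀ ω, Tendsto (fun s => Real.exp (-T s ω)) atTop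
      (𝓝 (expNeg (ENNReal.ofReal (c / 2) * S ω))) := fun ω => by
    refine tendsto_exp_neg_expNeg (fun s => hT0 s ω) ?_
    have h1 : Tendsto (fun s : Finset (Fin d → ℤ) => ENNReal.ofReal (c / 2) *
        ∑ n ∈ s, ENNReal.ofReal (b n * ‖fourierCoefficient (w ω) n‖ ^ 2)) atTop
        (𝓝 (ENNReal.ofReal (c / 2) * S ω)) :=
      ENNReal.Tendsto.const_mul ENNReal.summable.hasSum (Or.inr ENNReal.ofReal_ne_top)
    refine h1.congr fun s => ?_
    rw [← ENNReal.ofReal_sum_of_nonneg fun n _ => mul_nonneg (hb n) (sq_nonneg _),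
      ← ENNReal.ofReal_mul (by positivity)]
    congr 1
    simp only [T]
    rw [Finset.mul_sum, Finset.sum_div]
    exact Finset.sum_congr rfl fun n _ => by ring
  have hbound : ∀ s, 1 - ∫ ω, Real.exp (-T s ω) ∂P ≤ 2 * (η + C * (c * ∑' n, b n)) := fun s => by
    refine (one_sub_integral_exp_neg_partial_sobolevSum_le hw hf hwf hfb
      (a := fun n => c * b n) (fun n => mul_nonneg hc.le (hb n)) s).trans ?_
    rw [← Finset.mul_sum]
    have := hτ.sum_le_tsum s fun n _ => hb n
    gcongr
  have hintlim : Tendsto (fun s => ∫ ω, Real.exp (-T s ω) ∂P) atTop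
      (𝓝 (∫ ω, expNeg (ENNReal.ofReal (c / 2) * S ω) ∂P)) := by
    refine tendsto_integral_filter_of_dominated_convergence (fun _ => 1)
      (Eventually.of_forall fun s =>
        (Real.measurable_exp.comp (hTmeas s).neg).aestronglyMeasurable)
      (Eventually.of_forall fun s => ae_of_all _ fun ω => ?_) (integrable_const _)
      (ae_of_all _ hlim)
    rw [Real.norm_of_nonneg (Real.exp_nonneg _), Real.exp_le_one_iff]
    exact neg_nonpos.2 (hT0 s ω)
  refine le_trans ?_ (le_of_tendsto' (tendsto_const_nhds.sub hintlim) hbound)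
  have hset : MeasurableSet {ω | S ω < ⊤} := hS measurableSet_Iio
  have hPset : {ω | w ω ∈ sobolevSpace d τ} = {ω | S ω < ⊤} :=
    Set.ext fun _ => mem_sobolevSpace_iff
  rw [hPset, ← integral_indicator_one hset]
  refine sub_le_sub_left (integral_mono_of_nonneg (ae_of_all _ fun ω => ?_)
    ((integrable_const (1 : ℝ)).indicator hset) (ae_of_all _ fun ω =>
      expNeg_le_indicator S _ (by simpa using hc) ω)) 1
  simp only [Pi.zero_apply, expNeg]
  split_ifs
  · exact le_rfl
  · exact Real.exp_nonneg _

end PeriodicNoise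

end

theorem proposition4p1 (d : ℕ) {Ω : Type*} [MeasurableSpace Ω] (P : Measure Ω)
    [IsProbabilityMeasure P] (w : Ω → PeriodicNoise.GeneralizedFunction d)
    (hw : PeriodicNoise.IsPeriodicLevyWhiteNoise P w) (ε : ℝ) (hε : 0 < ε) :
    MeasurableSet {ω | w ω ∈ PeriodicNoise.sobolevSpace d (-(d : ℝ) / 2 - ε)} ∧
      P {ω | w ω ∈ PeriodicNoise.sobolevSpace d (-(d : ℝ) / 2 - ε)} = 1 := by
  obtain ⟨hwm, f, hf, hwf⟩ := hw
  refine ⟨hwm (PeriodicNoise.measurableSet_sobolevSpace _), ?_⟩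
  have hτ := PeriodicNoise.summable_one_add_latticeNorm_rpow d
    (s := 2 * (-(d : ℝ) / 2 - ε)) (by linarith)
  set A := ∑' n : Fin d → ℤ, (1 + PeriodicNoise.latticeNorm n) ^ (2 * (-(d : ℝ) / 2 - ε))
  have hA : 0 ≤ A := tsum_nonneg fun n =>
    Real.rpow_nonneg (add_nonneg zero_le_one (Real.sqrt_nonneg _)) _
  rw [← ENNReal.toReal_eq_one_iff, ← measureReal_def]
  refine le_antisymm measureReal_le_one (le_of_forall_pos_sub_le fun κ hκ => ?_)
  -- `η` is fixed before `C`, and `c` afterwards; each contributes at most `κ / 4` inside the factor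
  -- `2`. The `+ 1` in the denominator of `c` covers `C * A = 0`.
  obtain ⟨C, hC, hfb⟩ := hf.exists_norm_le_add (η := κ / 4) (by positivity)
  have h := PeriodicNoise.one_sub_measureReal_sobolevSpace_le hwm hf hwf hC hfb hτ
    (c := κ / (4 * (C * A + 1))) (by positivity)
  have h2 : C * (κ / (4 * (C * A + 1)) * A) ≤ κ / 4 := by
    have : 0 ≤ C * A := by positivity
    rw [div_mul_eq_mul_div, mul_div_assoc', div_le_div_iff₀ (by positivity) (by positivity)]
    nlinarith
  linarith
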